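/- Let $M\ge 1$ and consider $M$ bosonic modes with annihilation operators $a_1,\dots,a_M$ acting on the Fock space with number basis $|n_1,\dots,n_M\rangle$. Let $U_M$ be a multiport beamsplitter, that is, a unitary for which there is an $M\times M$ unitary matrix $\mathcal U$ with $U_M^\dagger a_m U_M=\sum_{m'}\mathcal U_{m,m'}a_{m'}$ for all $m$, and suppose that for some complex numbers $c_{m,m'}$ $$\sqrt M\,U_M^\dagger a_m U_M = a_1+\sum_{m'\neq 1}c_{m,m'}a_{m'}\qquad\text{for all } m=1,\dots,M .$$ For a one-mode state (positive operator of unit trace) $\rho_1$ put $\mathcal U_M(\rho_1):=U_M\bigl(\rho_1\otimes|0\rangle\langle 0|^{\otimes (M-1)}\bigr)U_M^\dagger$. Let $a_+:=\frac1{\sqrt M}\sum_{m=1}^M a_m$ be the centre-of-mass mode, and let $a_{-2},\dots,a_{-M}$ be any relative modes completing $a_+$ to a system of $M$ modes satisfying the canonical commutation relations, in the sense that there is a unitary $W$ on the Fock space with $Wa_1W^\dagger=a_+$ and $Wa_mW^\dagger=a_{-m}$ for $m\ge2$. For a state $\rho$ of the $M$ modes let $\operatorname{tr}_-\rho:=\operatorname{tr}_{2}\cdots\operatorname{tr}_{M}\bigl[W^\dagger\rho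 W\bigr]$ be the reduced state of the centre-of-mass mode, i.e. the partial trace of $\rho$ over the relative modes, written in the number basis of $a_+$. For a one-mode state $\rho$ let the Glauber $P$ function $P_\rho$ be the generalised function on $\mathbb C$ with $\rho=\int_{\mathbb C}P_\rho(\beta)|\beta\rangle\langle\beta|\,d^2\beta$, where $|\beta\rangle$ are the coherent states; its Fourier transform is $$\widehat{P_\rho}(\xi)=e^{|\xi|^2}\,\frac1\pi\int_{\mathbb C}\langle\alpha|\rho|\alpha\rangle\, e^{\xi\alpha^*-\xi^*\alpha}\,d^2\alpha .$$ For $\tau>0$ its Gaussian smoothing is $$R_{\rho,\tau}(\alpha)=\frac1{\pi\tau}\int_{\mathbb C}P_\rho(\beta)e^{-|\alpha-\beta|^2/\tau}\,d^2\beta:=\frac1{\pi^2}\int_{\mathbb C}\widehat{P_\rho}(\xi)\,e^{-\tau|\xi|^2}e^{\alpha\xi^*-\alpha^*\xi}\,d^2\xi ,$$ and the nonclassicality depth $\tau_c(\rho)$ is the infimum of those $\tau>0$ for which $\widehat{P_\rho}(\xi)e^{-\tau|\xi|^2}$ is integrable and $R_{\rho,\tau}(\alpha)\ge0$ for all $\alpha\in\mathbb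 C$. Then, for every choice of the relative modes, the sum over number states defining the partial trace converges (unconditionally in operator norm), $$\operatorname{tr}_-[\mathcal U_M(\rho_1)]=\rho_1,\qquad\text{and hence}\qquad \tau_c\bigl(\operatorname{tr}_-[\mathcal U_M(\rho_1)]\bigr)=\tau_c(\rho_1).$$ -/

import Mathlib

open scoped ComplexOrder

noncomputable section

namespace CVModes

/-! ## Fock spaces and annihilation operators -/

/-- The Hilbert space of one bosonic mode in the number representation, `ℓ²(ℕ)`:
`ψ p` is the amplitude of the number state `|p⟩`. -/
abbrev SingleMode : Type := lp (fun _ : ℕ => ℂ) 2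

/-- The Hilbert space of `M` bosonic modes in the number representation, `ℓ²(ℕ^M)`:
`ψ n` is the amplitude of `|n₁, …, n_M⟩`. -/
abbrev Fock (M : ℕ) : Type := lp (fun _ : Fin M → ℕ => ℂ) 2

/-- The formal action of the annihilation operator of mode `m` on amplitudes,
`(a_m ψ)(n) = √(n_m + 1) ψ(n + e_m)`, that is `a_m |n⟩ = √(n_m) |n - e_m⟩`. -/
def lowering {M : ℕ} (m : Fin M) : ((Fin M → ℕ) → ℂ) →ₗ[ℂ] ((Fin M → ℕ) → ℂ) where
  toFun ψ n := (Real.sqrt ((n m : ℝ) + 1) : ℂ) * ψ (n + Pi.single m 1)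
  map_add' ψ φ := by
    funext n
    simp [mul_add]
  map_smul' c ψ := by
    funext n
    simp only [Pi.smul_apply, smul_eq_mul, RingHom.id_apply]
    ring

/-- The square-summable amplitudes whose image under `lowering m` is square-summable. -/
def annihilationDomain {M : ℕ} (m : Fin M) : Submodule ℂ (Fock M) where
  carrier := {ψ | Memℓp (lowering m ψ) 2}
  add_mem' {ψ φ} hψ hφ := by
    have h := Memℓp.add hψ hφ
    rw [← map_add] at h
    exact h
  zero_mem' := by
    have h : lowering m (⇑(0 : Fock M)) = 0 := map_zero (lowering m)
    change Memℓp (lowering m (⇑(0 : Fock M))) 2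
    rw [h]
    exact zero_memℓp
  smul_mem' c ψ hψ := by
    have h := Memℓp.const_smul (𝕜 := ℂ) hψ c
    rw [← map_smul] at h
    exact h

/-- The annihilation operator `a_m` of mode `m`, as a (closed, unbounded) operator on its maximal
domain. -/
def annihilation {M : ℕ} (m : Fin M) : Fock M →ₗ.[ℂ] Fock M where
  domain := annihilationDomain m
  toFun :=
    { toFun := fun ψ => ⟨lowering m (ψ : Fock M), ψ.2⟩
      map_add' := fun ψ φ => Subtype.ext (map_add (lowering m) (⇑(ψ : Fock M)) (⇑(φ : Fock M)))
      map_smul' := fun c ψ => Subtype.ext (map_smul (lowering m) c (⇑(ψ : Fock M))) }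

/-- The Heisenberg relation `U† A U = B` for a unitary `U` and unbounded operators `A`, `B`, as an
identity on the domain of `B`: for `ψ ∈ dom B`, `U ψ ∈ dom A` and `A (U ψ) = U (B ψ)`. -/
def Transforms {M : ℕ} (U : Fock M ≃ₗᵢ[ℂ] Fock M) (A B : Fock M →ₗ.[ℂ] Fock M) : Prop :=
  ∀ ψ : B.domain, (U ψ, U (B ψ)) ∈ A.graph

/-- A multiport beamsplitter: a unitary `U` on the Fock space for which there is an `M × M` unitary
matrix `𝒰` with `U† a_m U = ∑ k, 𝒰 m k a_k` for all `m`. This action determines `U` up to a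
global phase. -/
def IsMultiportBeamsplitter {M : ℕ} (U : Fock M ≃ₗᵢ[ℂ] Fock M) : Prop :=
  ∃ 𝒰 ∈ Matrix.unitaryGroup (Fin M) ℂ,
    ∀ m, Transforms U (annihilation m) (∑ k, 𝒰 m k • annihilation k)

/-- The centre-of-mass mode `a_+ = (a_1 + ⋯ + a_M) / √M`. -/
def centreOfMass (M : ℕ) : Fock M →ₗ.[ℂ] Fock M :=
  ((Real.sqrt M : ℂ))⁻¹ • ∑ m : Fin M, annihilation m

/-! ## States, tensor products with number states, partial trace -/

/-- `U A U†`. -/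
def conjugate {M : ℕ} (U : Fock M ≃ₗᵢ[ℂ] Fock M) (A : Fock M →L[ℂ] Fock M) : Fock M →L[ℂ] Fock M :=
  (U : Fock M →L[ℂ] Fock M) ∘L A ∘L (U.symm : Fock M →L[ℂ] Fock M)

/-- A state of one mode: a positive operator of trace one. -/
structure IsState (ρ : SingleMode →L[ℂ] SingleMode) : Prop where
  isPositive : ρ.IsPositive
  trace_eq_one :
    HasSum (fun p : ℕ => inner ℂ (lp.single 2 p (1 : ℂ) : SingleMode) (ρ (lp.single 2 p 1))) 1

lemma cons_injective {N : ℕ} (k : Fin N → ℕ) :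
    Function.Injective (fun p : ℕ => (Fin.cons p k : Fin (N + 1) → ℕ)) :=
  fun p q h => by simpa using congrFun h 0

/-- The amplitudes of `ψ ⊗ |k⟩`. -/
def tensorAmplitude {N : ℕ} (k : Fin N → ℕ) (ψ : ℕ → ℂ) (n : Fin (N + 1) → ℕ) : ℂ :=
  if Fin.tail n = k then ψ (n 0) else 0

lemma tensorAmplitude_cons {N : ℕ} (k : Fin N → ℕ) (ψ : ℕ → ℂ) (p : ℕ) :
    tensorAmplitude k ψ (Fin.cons p k) = ψ p := by
  simp [tensorAmplitude]

lemma tensorAmplitude_eq_zero {N : ℕ} (k : Fin N → ℕ) (ψ : ℕ → ℂ) (n : Fin (N + 1) → ℕ)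
    (hn : n ∉ Set.range (fun p : ℕ => (Fin.cons p k : Fin (N + 1) → ℕ))) :
    tensorAmplitude k ψ n = 0 := by
  unfold tensorAmplitude
  rw [if_neg]
  rintro rfl
  exact hn ⟨n 0, Fin.cons_self_tail n⟩

lemma tensorAmplitude_memℓp {N : ℕ} (k : Fin N → ℕ) (ψ : SingleMode) :
    Memℓp (tensorAmplitude k ψ) 2 := by
  apply memℓp_gen
  refine ((cons_injective k).summable_iff ?_).1 ?_
  · intro n hn
    simp [tensorAmplitude_eq_zero k ψ n hn]
  · have h := (memℓp_gen_iff (p := 2) (by norm_num)).1 (lp.memℓp ψ)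
    simpa [Function.comp_def, tensorAmplitude_cons] using h

/-- The isometry `ψ ↦ ψ ⊗ |k⟩` from the first mode into `N + 1` modes, `|k⟩` being a number state
of the last `N` modes. -/
def tensorNumber {N : ℕ} (k : Fin N → ℕ) : SingleMode →ₗᵢ[ℂ] Fock (N + 1) where
  toFun ψ := ⟨tensorAmplitude k ψ, tensorAmplitude_memℓp k ψ⟩
  map_add' ψ φ := by
    ext n
    simp only [lp.coeFn_add, Pi.add_apply, tensorAmplitude]
    split_ifs <;> simp
  map_smul' c ψ := by
    ext n
    simp only [lp.coeFn_smul, Pi.smul_apply, tensorAmplitude, RingHom.id_apply]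
    split_ifs <;> simp
  norm_map' ψ := by
    have h2 : (0 : ℝ) < (2 : ENNReal).toReal := by norm_num
    have key : ∑' n, ‖tensorAmplitude k ψ n‖ ^ (2 : ENNReal).toReal
        = ∑' p, ‖ψ p‖ ^ (2 : ENNReal).toReal := by
      rw [← (cons_injective k).tsum_eq (f := fun n => ‖tensorAmplitude k ψ n‖ ^ (2 : ENNReal).toReal)]
      · simp only [tensorAmplitude_cons]
      · intro n hn
        by_contra hr
        exact hn (by simp [tensorAmplitude_eq_zero k ψ n hr])
    rw [lp.norm_eq_tsum_rpow h2, lp.norm_eq_tsum_rpow h2]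
    exact congrArg (fun x => x ^ (1 / (2 : ENNReal).toReal)) key

/-- `⟨k| A |k⟩`, the operator on the first mode obtained by sandwiching `A` between the number state
`|k⟩` of the last `N` modes. -/
def sandwich {N : ℕ} (k : Fin N → ℕ) (A : Fock (N + 1) →L[ℂ] Fock (N + 1)) :
    SingleMode →L[ℂ] SingleMode :=
  ContinuousLinearMap.adjoint (tensorNumber k).toContinuousLinearMap ∘L A ∘L
    (tensorNumber k).toContinuousLinearMap

/-- The partial trace over all modes but the first, `tr_2 ⋯ tr_M A = ∑_k ⟨k| A |k⟩`. (For a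
trace-class `A` the sum converges absolutely in the operator norm.) -/
def partialTrace {N : ℕ} (A : Fock (N + 1) →L[ℂ] Fock (N + 1)) : SingleMode →L[ℂ] SingleMode :=
  ∑' k : Fin N → ℕ, sandwich k A

/-- The operator `ρ₁ ⊗ |0⟩⟨0|^{⊗ N}` on `N + 1` modes. -/
def tensorVacuum {N : ℕ} (ρ₁ : SingleMode →L[ℂ] SingleMode) : Fock (N + 1) →L[ℂ] Fock (N + 1) :=
  (tensorNumber (0 : Fin N → ℕ)).toContinuousLinearMap ∘L ρ₁ ∘L
    ContinuousLinearMap.adjoint (tensorNumber (0 : Fin N → ℕ)).toContinuousLinearMap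

/-- The vacuum-interference state `U (ρ₁ ⊗ |0⟩⟨0|^{⊗ N}) U†`. -/
def vacuumInterference {N : ℕ} (U : Fock (N + 1) ≃ₗᵢ[ℂ] Fock (N + 1))
    (ρ₁ : SingleMode →L[ℂ] SingleMode) : Fock (N + 1) →L[ℂ] Fock (N + 1) :=
  conjugate U (tensorVacuum ρ₁)

/-- A choice of relative modes. Modes `a_+, a_{-2}, …, a_{-M}` satisfying the canonical commutation
relations are given by the unitary `W` with `W a_1 W† = a_+` and `W a_m W† = a_{-m}` for `m ≥ 2`;
the vectors `W |p, k⟩` are then the joint number states of these modes. So any unitary `W` with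
`W a_1 W† = a_+` is a choice of relative modes `a_{-m} := W a_m W†`. -/
def IsCollectiveFrame {N : ℕ} (W : Fock (N + 1) ≃ₗᵢ[ℂ] Fock (N + 1)) : Prop :=
  Transforms W.symm (annihilation 0) (centreOfMass (N + 1))

/-- The reduced centre-of-mass state `tr_- ρ`: the partial trace of `ρ` over the relative modes
`W a_m W†`, `m ≥ 2`, with the number states `W |p, k⟩` of the collective modes. -/
def reducedCentreOfMass {N : ℕ} (W : Fock (N + 1) ≃ₗᵢ[ℂ] Fock (N + 1))
    (ρ : Fock (N + 1) →L[ℂ] Fock (N + 1)) : SingleMode →L[ℂ] SingleMode :=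
  partialTrace (conjugate W.symm ρ)

/-! ## Glauber `P` function and nonclassicality depth -/

lemma coherentAmplitude_memℓp (α : ℂ) :
    Memℓp (fun n : ℕ => (Real.exp (-‖α‖ ^ 2 / 2) : ℂ) * α ^ n / (Real.sqrt n.factorial : ℂ)) 2 := by
  apply memℓp_gen
  have h := (Real.summable_pow_div_factorial (‖α‖ ^ 2)).mul_left (Real.exp (-‖α‖ ^ 2 / 2) ^ 2)
  refine h.congr fun n => ?_
  have hf : (0 : ℝ) ≤ (n.factorial : ℝ) := by positivity
  have e : ‖(Real.exp (-‖α‖ ^ 2 / 2) : ℂ) * α ^ n / (Real.sqrt n.factorial : ℂ)‖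
      = Real.exp (-‖α‖ ^ 2 / 2) * ‖α‖ ^ n / Real.sqrt n.factorial := by
    rw [norm_div, norm_mul, norm_pow, Complex.norm_real, Complex.norm_real,
      Real.norm_of_nonneg (Real.exp_pos _).le, Real.norm_of_nonneg (Real.sqrt_nonneg _)]
  rw [e]
  norm_num
  rw [div_pow, mul_pow, Real.sq_sqrt hf]
  ring

/-- The coherent state `|α⟩ = e^{-|α|²/2} ∑ₙ αⁿ/√(n!) |n⟩`. -/
def coherentState (α : ℂ) : SingleMode :=
  ⟨fun n : ℕ => (Real.exp (-‖α‖ ^ 2 / 2) : ℂ) * α ^ n / (Real.sqrt n.factorial : ℂ),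
    coherentAmplitude_memℓp α⟩

/-- `⟨α|ρ|α⟩`. -/
def coherentExpectation (ρ : SingleMode →L[ℂ] SingleMode) (α : ℂ) : ℂ :=
  inner ℂ (coherentState α) (ρ (coherentState α))

/-- The character `e^{ξ α* - ξ* α}` of the phase space `ℂ`. -/
def phase (ξ α : ℂ) : ℂ := Complex.exp (ξ * star α - star ξ * α)

/-- The Fourier transform `∫ P_ρ(β) e^{ξ β* - ξ* β} d²β` of the Glauber `P` function of `ρ`.
In general `P_ρ` is only a generalised function, but its Fourier transform is a continuous function:
`ρ = ∫ P_ρ(β) |β⟩⟨β| d²β` says that `⟨α|ρ|α⟩ = ∫ P_ρ(β) e^{-|α-β|²} d²β` for all `α` (these numbers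
determine `ρ`), and the Fourier transform turns this convolution into a product whose second factor
is `π e^{-|ξ|²}`. -/
def glauberFourier (ρ : SingleMode →L[ℂ] SingleMode) (ξ : ℂ) : ℂ :=
  (Real.exp (‖ξ‖ ^ 2) : ℂ) * ((Real.pi : ℂ)⁻¹ * ∫ α : ℂ, coherentExpectation ρ α * phase ξ α)

/-- The Fourier transform of `α ↦ (1/(πτ)) ∫ P_ρ(β) e^{-|α-β|²/τ} d²β`, namely that of `P_ρ` times
`e^{-τ|ξ|²}`. -/
def smoothedFourier (ρ : SingleMode →L[ℂ] SingleMode) (τ : ℝ) (ξ : ℂ) : ℂ :=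
  glauberFourier ρ ξ * (Real.exp (-τ * ‖ξ‖ ^ 2) : ℂ)

/-- The smoothed `P` function `α ↦ (1/(πτ)) ∫ P_ρ(β) e^{-|α-β|²/τ} d²β`, by Fourier inversion. -/
def smoothedP (ρ : SingleMode →L[ℂ] SingleMode) (τ : ℝ) (α : ℂ) : ℂ :=
  ((Real.pi : ℂ) ^ 2)⁻¹ * ∫ ξ : ℂ, smoothedFourier ρ τ ξ * phase α ξ

/-- The nonclassicality depth `τ_c(ρ)`: the infimum of the `τ > 0` for which the smoothed `P`
function exists as a function (its Fourier transform is integrable) and is nonnegative everywhere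
(`0 ≤ z` for complex `z` means that `z` is real and nonnegative). -/
def nonclassicalityDepth (ρ : SingleMode →L[ℂ] SingleMode) : ℝ :=
  sInf {τ : ℝ | 0 < τ ∧ MeasureTheory.Integrable (smoothedFourier ρ τ) ∧
    ∀ α : ℂ, 0 ≤ smoothedP ρ τ α}

end CVModes

end

/-!
Since `U† a_m U` has the coefficient `1/√M` on the first mode for every `m`, the operator
`(W† U)† a_1 (W† U) = U† a_+ U` lowers `|p, 0, …, 0⟩` exactly as `a_1` does. The recursion
`√(p + 1) φ_n(p + 1, k) = √n φ_{n-1}(p, k)` for the amplitudes of `φ_n = W† U |n, 0, …, 0⟩` makes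
`φ_n(n, k) = χ(k)` independent of `n`, and makes `φ_0` vanish off `p = 0`, so `‖χ‖ = ‖φ_0‖ = 1`.
As `‖φ_n‖ = 1` too, the amplitudes with `p = n` already exhaust the norm of `φ_n`, that is,
`φ_n = |n⟩ ⊗ χ`. Hence `W† U (ψ ⊗ |0⟩) = ψ ⊗ χ` for all `ψ`, and the partial trace of
`ρ₁ ⊗ |χ⟩⟨χ|` is `∑_k |χ(k)|² ρ₁ = ρ₁`.
-/

namespace CVModes

open ContinuousLinearMap (adjoint)

section Graph

variable {R E F : Type*} [CommRing R] [AddCommGroup E] [Module R E] [AddCommGroup F] [Module R F]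

theorem add_mem_graph {f g : E →ₗ.[R] F} {x : E} {y z : F} (hy : (x, y) ∈ f.graph)
    (hz : (x, z) ∈ g.graph) : (x, y + z) ∈ (f + g).graph := by
  obtain ⟨⟨x, hf⟩, rfl, rfl⟩ := f.mem_graph_iff.1 hy
  obtain ⟨⟨x', hg⟩, rfl, rfl⟩ := g.mem_graph_iff.1 hz
  exact (f + g).mem_graph ⟨x', hf, hg⟩

theorem smul_mem_graph {f : E →ₗ.[R] F} {x : E} {y : F} (a : R) (hy : (x, y) ∈ f.graph) :
    (x, a • y) ∈ (a • f).graph := by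
  obtain ⟨x, rfl, rfl⟩ := f.mem_graph_iff.1 hy
  exact (a • f).mem_graph x

theorem sum_mem_graph {ι : Type*} {f : ι → E →ₗ.[R] F} {x : E} {y : ι → F} (s : Finset ι)
    (h : ∀ i ∈ s, (x, y i) ∈ (f i).graph) : (x, ∑ i ∈ s, y i) ∈ (∑ i ∈ s, f i).graph := by
  classical
  induction s using Finset.induction_on with
  | empty => exact (0 : E →ₗ.[R] F).mem_graph ⟨x, Submodule.mem_top⟩
  | insert i s hi ih =>
    rw [Finset.sum_insert hi, Finset.sum_insert hi]
    exact add_mem_graph (h i (Finset.mem_insert_self i s))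
      (ih fun j hj => h j (Finset.mem_insert_of_mem hj))

end Graph

theorem Transforms.mem_graph {M : ℕ} {U : Fock M ≃ₗᵢ[ℂ] Fock M} {A B : Fock M →ₗ.[ℂ] Fock M}
    (h : Transforms U A B) {x y : Fock M} (hxy : (x, y) ∈ B.graph) : (U x, U y) ∈ A.graph := by
  obtain ⟨x, rfl, rfl⟩ := B.mem_graph_iff.1 hxy
  exact h x

theorem lowering_apply {M : ℕ} (m : Fin M) (ψ : (Fin M → ℕ) → ℂ) (n : Fin M → ℕ) :
    lowering m ψ n = (Real.sqrt (n m + 1) : ℂ) * ψ (n + Pi.single m 1) :=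
  rfl

theorem mem_graph_annihilation_iff {M : ℕ} {m : Fin M} {x y : Fock M} :
    (x, y) ∈ (annihilation m).graph ↔ lowering m x = y := by
  constructor
  · intro h
    obtain ⟨x, rfl, rfl⟩ := (annihilation m).mem_graph_iff.1 h
    rfl
  · intro h
    have hx : x ∈ annihilationDomain m := by
      change Memℓp (lowering m x) 2
      exact h ▸ lp.memℓp y
    exact (annihilation m).mem_graph_iff.2 ⟨⟨x, hx⟩, rfl, Subtype.ext h⟩

/-- The number state `|n⟩`, both for one mode (`ι = ℕ`) and for `M` modes (`ι = Fin M → ℕ`). -/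
noncomputable def numberState {ι : Type*} [DecidableEq ι] (n : ι) : lp (fun _ : ι => ℂ) 2 :=
  lp.single 2 n 1

theorem numberState_apply {ι : Type*} [DecidableEq ι] (n x : ι) :
    numberState n x = if x = n then 1 else 0 := by
  simp [numberState, lp.single_apply, Pi.single_apply]

theorem norm_numberState {ι : Type*} [DecidableEq ι] (n : ι) : ‖numberState n‖ = 1 := by
  rw [numberState, lp.norm_single (by norm_num), norm_one]

theorem inner_numberState_left {ι : Type*} [DecidableEq ι] (n : ι) (ψ : lp (fun _ : ι => ℂ) 2) :
    inner ℂ (numberState n) ψ = ψ n := by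
  simp [numberState, lp.inner_single_left]

/-- In the vacuum `n m = 0` of mode `m`, where `n - e_m` is truncated to `n`, the factor
`√(n m)` vanishes. -/
theorem annihilation_numberState {M : ℕ} (m : Fin M) (n : Fin M → ℕ) :
    (numberState n, (Real.sqrt (n m) : ℂ) • numberState (n - Pi.single m 1)) ∈
      (annihilation m).graph := by
  rw [mem_graph_annihilation_iff]
  funext x
  rw [lowering_apply, lp.coeFn_smul, Pi.smul_apply, smul_eq_mul, numberState_apply,
    numberState_apply]
  by_cases hx : x + Pi.single m 1 = n
  · subst hx
    simp
  · rw [if_neg hx, mul_zero]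
    rcases Nat.eq_zero_or_pos (n m) with hn | hn
    · simp [hn]
    · have hle : Pi.single m 1 ≤ n := update_le_iff.2 ⟨hn, fun j _ => (n j).zero_le⟩
      rw [if_neg fun h => hx (by rw [h, tsub_add_cancel_of_le hle]), mul_zero]

theorem tensorNumber_numberState {N : ℕ} (k : Fin N → ℕ) (p : ℕ) :
    tensorNumber k (numberState p) = numberState (Fin.cons p k) := by
  ext x
  cases x using Fin.consCases with
  | cons q l =>
    change tensorAmplitude k (numberState p) (Fin.cons q l) = _
    simp only [tensorAmplitude, Fin.tail_cons, Fin.cons_zero, numberState_apply, Fin.cons_inj,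
      ← ite_and, and_comm]

/-- The operator `A` lowers the sequence `φ` as an annihilation operator lowers the number states of
its mode: `A (φ n) = √n φ (n - 1)`, which is `0` for `n = 0`. -/
def IsLadder {E : Type*} [AddCommGroup E] [Module ℂ E] (A : E →ₗ.[ℂ] E) (φ : ℕ → E) : Prop :=
  ∀ n : ℕ, (φ n, (Real.sqrt n : ℂ) • φ (n - 1)) ∈ A.graph

theorem IsLadder.map_transforms {M : ℕ} {U : Fock M ≃ₗᵢ[ℂ] Fock M} {A B : Fock M →ₗ.[ℂ] Fock M}
    {φ : ℕ → Fock M} (hφ : IsLadder B φ) (hU : Transforms U A B) :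
    IsLadder A (fun n => U (φ n)) := fun n => by
  simpa only [map_smul] using hU.mem_graph (hφ n)

theorem isLadder_annihilation_zero_add_sum {N : ℕ} (c : Fin (N + 1) → ℂ) :
    IsLadder (annihilation 0 + ∑ m ∈ Finset.univ.erase 0, c m • annihilation m)
      (fun n => numberState (Fin.cons n (0 : Fin N → ℕ))) := fun n => by
  have hfirst : (numberState (Fin.cons n (0 : Fin N → ℕ)),
      (Real.sqrt n : ℂ) • numberState (Fin.cons (n - 1) (0 : Fin N → ℕ))) ∈
        (annihilation 0).graph := by
    have hsub : (Fin.cons n (0 : Fin N → ℕ) - Pi.single 0 1 : Fin (N + 1) → ℕ) =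
        Fin.cons (n - 1) (0 : Fin N → ℕ) := by
      funext i
      cases i using Fin.cases <;> simp
    rw [← hsub]
    exact annihilation_numberState 0 (Fin.cons n (0 : Fin N → ℕ))
  have hrest : ∀ m ≠ 0, (numberState (Fin.cons n (0 : Fin N → ℕ)), 0) ∈
      (annihilation m).graph := fun m hm => by
    obtain ⟨j, rfl⟩ := Fin.exists_succ_eq.2 hm
    simpa using annihilation_numberState j.succ (Fin.cons n (0 : Fin N → ℕ))
  simpa using add_mem_graph hfirst (sum_mem_graph (Finset.univ.erase 0) fun m hm =>
    smul_mem_graph (c m) (hrest m (Finset.ne_of_mem_erase hm)))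

theorem isLadder_centreOfMass {M : ℕ} [NeZero M] {φ : ℕ → Fock M}
    (hφ : ∀ m : Fin M, IsLadder ((Real.sqrt M : ℂ) • annihilation m) φ) :
    IsLadder (centreOfMass M) φ := fun n => by
  set s : ℂ := (Real.sqrt M : ℂ) with hs
  have hs_sq : s * s = M := by
    rw [hs, ← Complex.ofReal_mul, Real.mul_self_sqrt M.cast_nonneg, Complex.ofReal_natCast]
  have hs_ne : s ≠ 0 := left_ne_zero_of_mul (hs_sq ▸ NeZero.ne (M : ℂ))
  have hmode (m : Fin M) :
      (φ n, s⁻¹ • (Real.sqrt n : ℂ) • φ (n - 1)) ∈ (annihilation m).graph := by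
    simpa only [inv_smul_smul₀ hs_ne] using smul_mem_graph s⁻¹ (hφ m n)
  have hsum := smul_mem_graph s⁻¹ (sum_mem_graph Finset.univ fun m _ => hmode m)
  have hscalar : s⁻¹ * M * s⁻¹ = 1 := by
    rw [← hs_sq]
    field_simp
  rwa [Finset.sum_const, Finset.card_univ, Fintype.card_fin, ← Nat.cast_smul_eq_nsmul ℂ,
    smul_smul, smul_smul, hscalar, one_smul] at hsum

theorem IsCollectiveFrame.isLadder {N : ℕ} {U W : Fock (N + 1) ≃ₗᵢ[ℂ] Fock (N + 1)}
    {c : Fin (N + 1) → Fin (N + 1) → ℂ} (hW : IsCollectiveFrame W)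
    (hU : ∀ m, Transforms U ((Real.sqrt (N + 1 : ℕ) : ℂ) • annihilation m)
      (annihilation 0 + ∑ m' ∈ Finset.univ.erase 0, c m m' • annihilation m')) :
    IsLadder (annihilation 0)
      (fun n => W.symm (U (numberState (Fin.cons n (0 : Fin N → ℕ))))) :=
  (isLadder_centreOfMass fun m =>
    (isLadder_annihilation_zero_add_sum (c m)).map_transforms (hU m)).map_transforms hW

theorem hasSum_norm_sq {ι : Type*} (f : lp (fun _ : ι => ℂ) 2) :
    HasSum (fun i => ‖f i‖ ^ 2) (‖f‖ ^ 2) := by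
  simpa using lp.hasSum_norm (p := 2) (by norm_num) f

theorem eq_zero_of_hasSum_comp_injective {ι κ : Type*} {f : ι → ℝ} {e : κ → ι} {s : ℝ}
    (hf : ∀ i, 0 ≤ f i) (he : Function.Injective e) (hs : HasSum f s)
    (hse : HasSum (fun j => f (e j)) s) {i : ι} (hi : i ∉ Set.range e) : f i = 0 := by
  have hrange : HasSum ((Set.range e).indicator f) s :=
    hasSum_subtype_iff_indicator.1 (he.hasSum_range_iff.2 hse)
  have hcompl : HasSum (f - (Set.range e).indicator f) 0 :=
    sub_self s ▸ hs.sub hrange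
  have hnonneg : 0 ≤ f - (Set.range e).indicator f :=
    sub_nonneg.2 (Set.indicator_le_self' fun j _ => hf j)
  simpa [hi] using congrFun ((hasSum_zero_iff_of_nonneg hnonneg).1 hcompl) i

namespace IsLadder

variable {N : ℕ} {φ : ℕ → Fock (N + 1)}

theorem sqrt_mul_apply_cons_succ (hφ : IsLadder (annihilation 0) φ) (n p : ℕ) (k : Fin N → ℕ) :
    (Real.sqrt (p + 1) : ℂ) * φ n (Fin.cons (p + 1) k) =
      (Real.sqrt n : ℂ) * φ (n - 1) (Fin.cons p k) := by
  have hshift : (Fin.cons p k + Pi.single 0 1 : Fin (N + 1) → ℕ) = Fin.cons (p + 1) k := by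
    funext i
    cases i using Fin.cases <;> simp
  have happly := congrFun (mem_graph_annihilation_iff.1 (hφ n)) (Fin.cons p k)
  rwa [lowering_apply, hshift, lp.coeFn_smul, Pi.smul_apply, smul_eq_mul, Fin.cons_zero] at happly

theorem zero_apply_cons_succ (hφ : IsLadder (annihilation 0) φ) (p : ℕ) (k : Fin N → ℕ) :
    φ 0 (Fin.cons (p + 1) k) = 0 := by
  have hp : (Real.sqrt (p + 1) : ℂ) ≠ 0 := by exact_mod_cast (by positivity)
  simpa [hp] using hφ.sqrt_mul_apply_cons_succ 0 p k

theorem apply_cons_self (hφ : IsLadder (annihilation 0) φ) (n : ℕ) (k : Fin N → ℕ) :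
    φ n (Fin.cons n k) = φ 0 (Fin.cons 0 k) := by
  induction n with
  | zero => rfl
  | succ n ih =>
    have hn : (Real.sqrt (n + 1) : ℂ) ≠ 0 := by exact_mod_cast (by positivity)
    rw [← ih]
    exact mul_left_cancel₀ hn (by simpa using hφ.sqrt_mul_apply_cons_succ (n + 1) n k)

theorem hasSum_norm_sq_apply_cons_self (hφ : IsLadder (annihilation 0) φ) (n : ℕ) :
    HasSum (fun k : Fin N → ℕ => ‖φ n (Fin.cons n k)‖ ^ 2) (‖φ 0‖ ^ 2) := by
  simp only [hφ.apply_cons_self n]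
  refine ((Fin.cons_right_injective 0).hasSum_iff fun x hx => ?_).2 (hasSum_norm_sq (φ 0))
  cases x using Fin.consCases with
  | cons p k =>
    cases p with
    | zero => exact absurd ⟨k, rfl⟩ hx
    | succ p => simp [hφ.zero_apply_cons_succ]

theorem apply_cons (hφ : IsLadder (annihilation 0) φ) {n : ℕ} (hnorm : ‖φ n‖ = ‖φ 0‖) (p : ℕ)
    (k : Fin N → ℕ) : φ n (Fin.cons p k) = if p = n then φ 0 (Fin.cons 0 k) else 0 := by
  split_ifs with hp
  · rw [hp, hφ.apply_cons_self]
  · have hrange : Fin.cons p k ∉ Set.range (Fin.cons (α := fun _ : Fin (N + 1) => ℕ) n) := by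
      rintro ⟨l, hl⟩
      exact hp (Fin.cons_inj.1 hl).1.symm
    have hsum : HasSum (fun x => ‖φ n x‖ ^ 2) (‖φ 0‖ ^ 2) := hnorm ▸ hasSum_norm_sq (φ n)
    have hsq : ‖φ n (Fin.cons p k)‖ ^ 2 = 0 :=
      eq_zero_of_hasSum_comp_injective (f := fun x => ‖φ n x‖ ^ 2)
        (e := Fin.cons (α := fun _ : Fin (N + 1) => ℕ) n) (fun x => sq_nonneg ‖φ n x‖)
        (Fin.cons_right_injective (α := fun _ => ℕ) n) hsum
        (hφ.hasSum_norm_sq_apply_cons_self n) hrange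
    exact norm_eq_zero.1 (sq_eq_zero_iff.1 hsq)

end IsLadder

theorem adjoint_tensorNumber_apply {N : ℕ} (k : Fin N → ℕ) (φ : Fock (N + 1)) (p : ℕ) :
    adjoint (tensorNumber k).toContinuousLinearMap φ p = φ (Fin.cons p k) := by
  rw [← inner_numberState_left p, ContinuousLinearMap.adjoint_inner_right,
    LinearIsometry.coe_toContinuousLinearMap, tensorNumber_numberState, inner_numberState_left]

/-- The hypothesis says that `J ψ = ψ ⊗ χ`, for `χ = ∑ k, χ k |k⟩`. -/
theorem adjoint_tensorNumber_comp {N : ℕ} {J : SingleMode →L[ℂ] Fock (N + 1)}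
    {χ : (Fin N → ℕ) → ℂ}
    (hJ : ∀ n p k, J (numberState n) (Fin.cons p k) = if p = n then χ k else 0)
    (k : Fin N → ℕ) :
    adjoint (tensorNumber k).toContinuousLinearMap ∘L J =
      χ k • ContinuousLinearMap.id ℂ SingleMode := by
  refine lp.ext_continuousLinearMap (by norm_num) fun n => ?_
  ext p
  change adjoint (tensorNumber k).toContinuousLinearMap
    (J (numberState n)) p = χ k * numberState n p
  rw [adjoint_tensorNumber_apply, hJ, numberState_apply, mul_ite, mul_one, mul_zero]

theorem sandwich_comp_comp_adjoint {N : ℕ} {J : SingleMode →L[ℂ] Fock (N + 1)} {k : Fin N → ℕ}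
    {z : ℂ} (hJ : adjoint (tensorNumber k).toContinuousLinearMap ∘L J =
      z • ContinuousLinearMap.id ℂ SingleMode) (ρ : SingleMode →L[ℂ] SingleMode) :
    sandwich k (J ∘L ρ ∘L adjoint J) = ((‖z‖ ^ 2 : ℝ) : ℂ) • ρ := by
  have hJadj : adjoint J ∘L (tensorNumber k).toContinuousLinearMap =
      star z • ContinuousLinearMap.id ℂ SingleMode := by
    simpa only [ContinuousLinearMap.adjoint_comp, ContinuousLinearMap.adjoint_adjoint,
      map_smulₛₗ, ContinuousLinearMap.adjoint_id, starRingEnd_apply]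
      using congrArg adjoint hJ
  calc sandwich k (J ∘L ρ ∘L adjoint J)
    _ = (adjoint (tensorNumber k).toContinuousLinearMap ∘L J) ∘L ρ ∘L
          (adjoint J ∘L (tensorNumber k).toContinuousLinearMap) := rfl
    _ = (z * star z) • ρ := by
      rw [hJ, hJadj]
      ext1 ψ
      simp [smul_smul, mul_comm]
    _ = ((‖z‖ ^ 2 : ℝ) : ℂ) • ρ := by
      rw [← starRingEnd_apply, Complex.mul_conj', Complex.ofReal_pow]

theorem hasSum_sandwich_of_isLadder {N : ℕ} {J : SingleMode →ₗᵢ[ℂ] Fock (N + 1)}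
    (hJ : IsLadder (annihilation 0) fun n => J (numberState n))
    (ρ : SingleMode →L[ℂ] SingleMode) :
    HasSum (fun k : Fin N → ℕ => sandwich k (J.toContinuousLinearMap ∘L ρ ∘L
      adjoint J.toContinuousLinearMap)) ρ := by
  have hnorm (n : ℕ) : ‖J (numberState n)‖ = 1 := by rw [J.norm_map, norm_numberState]
  have hslice (k : Fin N → ℕ) := sandwich_comp_comp_adjoint (adjoint_tensorNumber_comp
    (J := J.toContinuousLinearMap)
    (fun n => hJ.apply_cons ((hnorm n).trans (hnorm 0).symm)) k) ρ
  simp only [hslice]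
  simpa [hnorm] using (Complex.hasSum_ofReal.2 (hJ.hasSum_norm_sq_apply_cons_self 0)).smul_const ρ

theorem conjugate_vacuumInterference {N : ℕ} (V U : Fock (N + 1) ≃ₗᵢ[ℂ] Fock (N + 1))
    (ρ : SingleMode →L[ℂ] SingleMode) :
    let J := (U.trans V).toLinearIsometry.comp (tensorNumber (0 : Fin N → ℕ))
    conjugate V (vacuumInterference U ρ) =
      J.toContinuousLinearMap ∘L ρ ∘L adjoint J.toContinuousLinearMap := by
  intro J
  have hJ : J.toContinuousLinearMap = (U.trans V : Fock (N + 1) →L[ℂ] Fock (N + 1)) ∘L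
      (tensorNumber (0 : Fin N → ℕ)).toContinuousLinearMap := rfl
  rw [hJ, ContinuousLinearMap.adjoint_comp, LinearIsometryEquiv.adjoint_eq_symm]
  rfl

end CVModes

theorem mainTheorem6_general {N : ℕ}
    {U W : CVModes.Fock (N + 1) ≃ₗᵢ[ℂ] CVModes.Fock (N + 1)} {c : Fin (N + 1) → Fin (N + 1) → ℂ}
    (hU : ∀ m, CVModes.Transforms U
      ((Real.sqrt (N + 1 : ℕ) : ℂ) • CVModes.annihilation m)
      (CVModes.annihilation 0 + ∑ m' ∈ Finset.univ.erase 0, c m m' • CVModes.annihilation m'))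
    (hW : CVModes.IsCollectiveFrame W)
    (ρ : CVModes.SingleMode →L[ℂ] CVModes.SingleMode) :
    HasSum (fun k : Fin N → ℕ =>
      CVModes.sandwich k (CVModes.conjugate W.symm (CVModes.vacuumInterference U ρ))) ρ := by
  rw [CVModes.conjugate_vacuumInterference]
  refine CVModes.hasSum_sandwich_of_isLadder ?_ ρ
  simpa [CVModes.tensorNumber_numberState] using hW.isLadder hU

theorem mainTheorem6 (N : ℕ)
    (U : CVModes.Fock (N + 1) ≃ₗᵢ[ℂ] CVModes.Fock (N + 1))
    (hU : CVModes.IsMultiportBeamsplitter U)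
    (c : Fin (N + 1) → Fin (N + 1) → ℂ)
    (hc : ∀ m, CVModes.Transforms U
      ((Real.sqrt (N + 1 : ℕ) : ℂ) • CVModes.annihilation m)
      (CVModes.annihilation 0 + ∑ m' ∈ Finset.univ.erase 0, c m m' • CVModes.annihilation m'))
    (W : CVModes.Fock (N + 1) ≃ₗᵢ[ℂ] CVModes.Fock (N + 1))
    (hW : CVModes.IsCollectiveFrame W)
    (ρ₁ : CVModes.SingleMode →L[ℂ] CVModes.SingleMode)
    (hρ₁ : CVModes.IsState ρ₁) :
    Summable (fun k : Fin N → ℕ =>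
        CVModes.sandwich k (CVModes.conjugate W.symm (CVModes.vacuumInterference U ρ₁))) ∧
      CVModes.reducedCentreOfMass W (CVModes.vacuumInterference U ρ₁) = ρ₁ ∧
      CVModes.nonclassicalityDepth
          (CVModes.reducedCentreOfMass W (CVModes.vacuumInterference U ρ₁)) =
        CVModes.nonclassicalityDepth ρ₁ := by
  have htrace := mainTheorem6_general hc hW ρ₁
  exact ⟨htrace.summable, htrace.tsum_eq, congrArg CVModes.nonclassicalityDepth htrace.tsum_eq⟩
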